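/- Let $N\ge 2$ and regard $V_N=\{0,1,\dots,N\}$ as the vertex set of a cycle of length $N+1$ (arithmetic modulo $N+1$, so $-1$ denotes $N$; no parity assumption is made). Fix $\epsilon>0$ and let $P$ be the lazy random walk on this cycle in which the edge $\{0,1\}$ has weight $1+\epsilon$ and every other edge has weight $1$: \[ P(x,y)=\begin{cases} \frac12 & \text{if } x=y,\\ \frac14 & \text{if } y=x\pm1 \text{ and } x\notin\{0,1\},\\ \frac{1+\epsilon}{2(2+\epsilon)} & \text{if } (x,y)\in\{(0,1),(1,0)\},\\ \frac{1}{2(2+\epsilon)} & \text{if } (x,y)\in\{(0,-1),(1,2)\},\\ 0 & \text{otherwise.} \end{cases} \] Let $g$ be any permutation of $V_N$, and set $\widetilde P(x,y)=P(x,g^{-1}y)$, and $P_i(x,y)=P(g^{i-1}x,g^{i-1}y)$ for $i=1,2,\dots$. Then $\widetilde P$ has a unique invariant probability measure $\widetilde\pi$, and \[ \max_{x\in V_N}\widetilde\pi(x)\le(1+\epsilon)\min_{x\in V_N}\widetilde\pi(x). \] Furthermore, writing $P_{0,n}=P_1P_2\cdots P_n$ (with $P_{0,0}=I$) and, for $\eta>0$,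 \[ T_\infty(\eta)=\min\Bigl\{n\ge 0:\ \max_{x,y,z\in V_N}\Bigl|\frac{P_{0,n}(x,z)}{P_{0,n}(y,z)}-1\Bigr|<\eta\Bigr\} \] (where the maximum is understood to be $+\infty$ if some $P_{0,n}(y,z)=0$), there is a constant $C(\epsilon)$, depending only on $\epsilon$ (not on $N$, $g$ or $\eta$), such that for all $\eta>0$ the time $T_\infty(\eta)$ is finite and \[ T_\infty(\eta)\le C(\epsilon)\,N^2\,(1+\log_+ 1/\eta),\qquad \log_+ t=\max\{0,\log t\}. \] -/

import Mathlib

open scoped ENNReal Matrix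

namespace WaveChain

noncomputable section

/-- The lazy kernel `P` on the cycle `{0, …, N}` (addition modulo `N + 1`, so that `-1` is the
vertex `N`), where the edge `{0, 1}` has weight `1 + ε` and every other edge has weight `1`:
hold with probability `1/2`, otherwise step to a neighbour with probability proportional to
the weight of the connecting edge. It is meant for `2 ≤ N`, i.e. at least three vertices. -/
def lazyCircle (N : ℕ) (ε : ℝ) : Matrix (ZMod (N + 1)) (ZMod (N + 1)) ℝ := fun x y =>
  if x = y then 1 / 2
  else if (y = x + 1 ∨ y = x - 1) ∧ x ≠ 0 ∧ x ≠ 1 then 1 / 4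
  else if (x = 0 ∧ y = 1) ∨ (x = 1 ∧ y = 0) then (1 + ε) / (2 * (2 + ε))
  else if (x = 0 ∧ y = -1) ∨ (x = 1 ∧ y = 2) then 1 / (2 * (2 + ε))
  else 0

variable {V : Type*}

/-- The kernels `K_i(x, y) = K(g^(i-1) x, g^(i-1) y)`, for `i = 1, 2, …` (the index `0` is
never used). -/
def shifted (K : Matrix V V ℝ) (g : Equiv.Perm V) (i : ℕ) : Matrix V V ℝ :=
  fun x y => K ((g ^ (i - 1)) x) ((g ^ (i - 1)) y)

/-- The kernel `K̃(x, y) = K(x, g⁻¹ y)`. -/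
def tilde (K : Matrix V V ℝ) (g : Equiv.Perm V) : Matrix V V ℝ :=
  fun x y => K x (g⁻¹ y)

/-- `π` is an invariant probability measure of the kernel `K`. -/
def IsInvariantProb [Fintype V] (K : Matrix V V ℝ) (π : V → ℝ) : Prop :=
  (∀ x, 0 ≤ π x) ∧ ∑ x, π x = 1 ∧ π ᵥ* K = π

/-- The iterated kernel `K_{0,n} = K_1 K_2 ⋯ K_n` of a sequence of kernels `K_1, K_2, …`. -/
def iterKernel [Fintype V] [DecidableEq V] (K : ℕ → Matrix V V ℝ) : ℕ → Matrix V V ℝ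
  | 0 => 1
  | n + 1 => iterKernel K n * K (n + 1)

/-- The relative-sup distance `max_x |μ(x)/ν(x) - 1|`, which is infinite
if `ν` vanishes somewhere. -/
def relSupDist (μ ν : V → ℝ) : ℝ≥0∞ :=
  ⨆ x, if ν x = 0 then ⊤ else ENNReal.ofReal |μ x / ν x - 1|

/-- The `η` relative-sup merging time of the chain driven by `K_1, K_2, …`: the least `n` with
`max_{x,y,z} |K_{0,n}(x,z) / K_{0,n}(y,z) - 1| < η`, and `⊤` if there is no such `n`. -/
def mergingTime [Fintype V] [DecidableEq V] (K : ℕ → Matrix V V ℝ) (η : ℝ) : ℕ∞ :=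
  ⨅ (n : ℕ) (_ : ⨆ x, ⨆ y, relSupDist (iterKernel K n x) (iterKernel K n y)
    < ENNReal.ofReal η), (n : ℕ∞)

end

end WaveChain

/-!
Write `K = tilde P g` for `P = lazyCircle N ε`. The shifted product `P₁ ⋯ Pₙ` is the `n`-th power
of `K` up to the relabelling `gⁿ` of the target (`iterKernel_shifted_apply`), so merging is a
statement about the powers of one kernel.

**The invariant probability.** An invariant vector `f` of `K` satisfies `f (g z) = (f P) z`.
Existence is a determinant argument (`exists_isInvariantProb`) and uniqueness is irreducibility
(`forall_of_perm_closed`). Column sums of `P` exceed `1` only at the ends `0, 1` of the heavy edge,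
so the maximum of `f` must be the image of one of these (`exists_max_at_heavy`); in the same way
the minimum is the image of one of `-1, 2` (`exists_min_at_light`). Comparing the balance
equations at these two vertices gives the factor `1 + ε`
(`IsInvariantProb.le_one_add_mul`). In particular the invariant probability `π` is comparable to
the uniform one, with a constant depending on `ε` alone.

**Merging.** For a Markov kernel with invariant weight `π`, one step lowers the second moment
`∑ π F²` by at least a constant times `(N + 1)⁻¹ ∑ (F (e (z + 1)) - F (e z))²` as soon as some
state can move to both `e z` and `e (z + 1)`, for each `z`; here `e` is any cyclic ordering of
the vertices (`IsMarkovWith.sum_mul_mulVec_sq_le`). On a cycle this energy dominates the second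
moment `u` of a centered function by a Poincaré inequality, and dominates `u ^ 3` by a Nash
inequality if the function has bounded `L¹` norm. With `t` of order `(N + 1)⁻²`, the resulting
recursions `u' ≤ u - t u³` and `u' ≤ u - t u` bring `u` below `1` in time of order `1 / t` whatever
the starting value, hence without a logarithmic factor in `N`, and make it decay exponentially
afterwards (`le_exp_of_nash_of_poincare`). This applies to `K` with the order `e = g` and to its
time reversal with the standard order; the two bounds are combined through
`IsMarkovWith.sq_relative_error_le` into a uniform bound on `K ^ (2 k) x z / π z - 1`.
-/

namespace WaveChain

/-! ### Functions on the cycle -/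

theorem abs_sub_le_sum_gradient {N : ℕ} (ψ : ZMod (N + 1) → ℝ) (x y : ZMod (N + 1)) :
    |ψ x - ψ y| ≤ ∑ z, |ψ (z + 1) - ψ z| := by
  have tele : ∀ k : ℕ, |ψ (y + k) - ψ y| ≤
      ∑ i ∈ Finset.range k, |ψ (y + i + 1) - ψ (y + i)| := by
    intro k
    induction k with
    | zero => simp
    | succ k ih =>
      rw [Finset.sum_range_succ, Nat.cast_succ, ← add_assoc]
      calc |ψ (y + k + 1) - ψ y| = |(ψ (y + k) - ψ y) + (ψ (y + k + 1) - ψ (y + k))| := by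
            congr 1; ring
        _ ≤ _ := (abs_add_le _ _).trans (by linarith)
  have hx : x = y + ((x - y).val : ZMod (N + 1)) := by simp
  have hinj : Set.InjOn (fun i : ℕ => y + (i : ZMod (N + 1)))
      (Finset.range (x - y).val : Set ℕ) := by
    intro i hi j hj hij
    have hlt := ZMod.val_lt (x - y)
    simp only [Finset.coe_range, Set.mem_Iio] at hi hj
    have h := congrArg ZMod.val (add_left_cancel hij)
    rwa [ZMod.val_natCast_of_lt (hi.trans hlt), ZMod.val_natCast_of_lt (hj.trans hlt)] at h
  calc |ψ x - ψ y| = |ψ (y + ((x - y).val : ZMod (N + 1))) - ψ y| := by rw [← hx]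
    _ ≤ _ := tele _
    _ = ∑ z ∈ (Finset.range (x - y).val).image (fun i : ℕ => y + (i : ZMod (N + 1))),
          |ψ (z + 1) - ψ z| := (Finset.sum_image (f := fun z => |ψ (z + 1) - ψ z|) hinj).symm
    _ ≤ _ := Finset.sum_le_univ_sum_of_nonneg fun _ => abs_nonneg _

theorem abs_le_sum_gradient {N : ℕ} {ψ : ZMod (N + 1) → ℝ} {x₀ x₁ : ZMod (N + 1)}
    (h₀ : ψ x₀ ≤ 0) (h₁ : 0 ≤ ψ x₁) (x : ZMod (N + 1)) :
    |ψ x| ≤ ∑ z, |ψ (z + 1) - ψ z| := by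
  have a := (abs_le.1 (abs_sub_le_sum_gradient ψ x x₀)).2
  have b := (abs_le.1 (abs_sub_le_sum_gradient ψ x x₁)).1
  exact abs_le.2 ⟨by linarith, by linarith⟩

/-- The `ℓ^∞` Poincaré inequality on the cycle. -/
theorem sq_le_card_mul_energy {N : ℕ} {h : ZMod (N + 1) → ℝ} {x₀ x₁ : ZMod (N + 1)}
    (h₀ : h x₀ ≤ 0) (h₁ : 0 ≤ h x₁) (x : ZMod (N + 1)) :
    h x ^ 2 ≤ (N + 1) * ∑ z, (h (z + 1) - h z) ^ 2 := by
  have a := abs_le_sum_gradient h₀ h₁ x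
  have b := sq_sum_le_card_mul_sum_sq (s := Finset.univ) (f := fun z => |h (z + 1) - h z|)
  simp only [sq_abs, Finset.card_univ, ZMod.card, Nat.cast_add, Nat.cast_one] at b
  calc h x ^ 2 = |h x| ^ 2 := (sq_abs _).symm
    _ ≤ (∑ z, |h (z + 1) - h z|) ^ 2 := by gcongr
    _ ≤ _ := b

/-- The one-dimensional Gagliardo–Nirenberg inequality on the cycle, obtained by applying the
oscillation bound to `h * |h|`. -/
theorem pow_four_le_energy_mul_sum_sq {N : ℕ} {h : ZMod (N + 1) → ℝ} {x₀ x₁ : ZMod (N + 1)}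
    (h₀ : h x₀ ≤ 0) (h₁ : 0 ≤ h x₁) (x : ZMod (N + 1)) :
    h x ^ 4 ≤ 4 * (∑ z, (h (z + 1) - h z) ^ 2) * ∑ z, h z ^ 2 := by
  have a := abs_le_sum_gradient (ψ := fun z => h z * |h z|) (x₀ := x₀) (x₁ := x₁)
    (mul_nonpos_of_nonpos_of_nonneg h₀ (abs_nonneg _)) (mul_nonneg h₁ (abs_nonneg _)) x
  have key : ∀ s t : ℝ, |s * |s| - (t * |t|)| ≤ |s - t| * (|s| + |t|) := by
    intro s t
    rw [← abs_of_nonneg (add_nonneg (abs_nonneg s) (abs_nonneg t)), ← abs_mul]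
    apply sq_le_sq.1
    rcases le_total 0 s with hs | hs <;> rcases le_total 0 t with ht | ht <;>
      simp only [abs_of_nonneg, abs_of_nonpos, hs, ht]
    · exact le_of_eq (by ring)
    · have : 0 ≤ s * (-t) := mul_nonneg hs (by linarith)
      nlinarith [mul_nonneg this (add_nonneg (sq_nonneg s) (sq_nonneg t)), mul_nonneg this this]
    · have : 0 ≤ (-s) * t := mul_nonneg (by linarith) ht
      nlinarith [mul_nonneg this (add_nonneg (sq_nonneg s) (sq_nonneg t)), mul_nonneg this this]
    · exact le_of_eq (by ring)
  have b : h x ^ 2 ≤ ∑ z, |h (z + 1) - h z| * (|h (z + 1)| + |h z|) := by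
    calc h x ^ 2 = |(h x * |h x|)| := by rw [abs_mul, abs_abs, ← sq, sq_abs]
      _ ≤ _ := a
      _ ≤ _ := Finset.sum_le_sum fun z _ => key _ _
  have c := Finset.sum_mul_sq_le_sq_mul_sq Finset.univ (fun z => |h (z + 1) - h z|)
    (fun z => |h (z + 1)| + |h z|)
  have hshift : ∑ z, h (z + 1) ^ 2 = ∑ z, h z ^ 2 :=
    Equiv.sum_comp (Equiv.addRight (1 : ZMod (N + 1))) fun z => h z ^ 2
  have d : ∑ z, (|h (z + 1)| + |h z|) ^ 2 ≤ 4 * ∑ z, h z ^ 2 := by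
    calc ∑ z, (|h (z + 1)| + |h z|) ^ 2 ≤ ∑ z, (2 * h (z + 1) ^ 2 + 2 * h z ^ 2) := by
          refine Finset.sum_le_sum fun z _ => ?_
          nlinarith [sq_abs (h (z + 1)), sq_abs (h z), sq_nonneg (|h (z + 1)| - |h z|)]
      _ = _ := by rw [Finset.sum_add_distrib, ← Finset.mul_sum, ← Finset.mul_sum, hshift]; ring
  have e : 0 ≤ ∑ z, (h (z + 1) - h z) ^ 2 := Finset.sum_nonneg fun _ _ => sq_nonneg _
  simp only [sq_abs] at c
  calc h x ^ 4 = (h x ^ 2) ^ 2 := by ring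
    _ ≤ (∑ z, |h (z + 1) - h z| * (|h (z + 1)| + |h z|)) ^ 2 := by gcongr
    _ ≤ _ := c
    _ ≤ (∑ z, (h (z + 1) - h z) ^ 2) * (4 * ∑ z, h z ^ 2) := by gcongr
    _ = _ := by ring

theorem exists_nonpos_of_weighted_sum_eq_zero {V : Type*} [Fintype V] [Nonempty V]
    {μ h : V → ℝ} (hμ : ∀ x, 0 < μ x) (h0 : ∑ x, μ x * h x = 0) : ∃ x, h x ≤ 0 := by
  by_contra! hc
  have : 0 < ∑ x, μ x * h x :=
    Finset.sum_pos (fun x _ => mul_pos (hμ x) (hc x)) Finset.univ_nonempty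
  linarith

section Functional

variable {N : ℕ} {a : ℝ} {μ : ZMod (N + 1) → ℝ}

/-- Poincaré inequality for the weight `μ`; the gradient is taken along the cyclic order `e`. -/
theorem poincare (hμ : ∀ x, 0 < μ x) (hμ1 : ∑ x, μ x = 1)
    (e : Equiv.Perm (ZMod (N + 1))) {h : ZMod (N + 1) → ℝ} (h0 : ∑ x, μ x * h x = 0) :
    ∑ x, μ x * h x ^ 2 ≤ (N + 1) * ∑ z, (h (e (z + 1)) - h (e z)) ^ 2 := by
  obtain ⟨x₀, h₀⟩ := exists_nonpos_of_weighted_sum_eq_zero hμ h0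
  obtain ⟨x₁, h₁⟩ := exists_nonpos_of_weighted_sum_eq_zero (h := fun x => -h x) hμ
    (by simpa using h0)
  have key : ∀ x, h x ^ 2 ≤ (N + 1) * ∑ z, (h (e (z + 1)) - h (e z)) ^ 2 := fun x => by
    simpa using sq_le_card_mul_energy (h := fun z => h (e z)) (x₀ := e.symm x₀)
      (x₁ := e.symm x₁) (by simpa using h₀) (by simpa using h₁) (e.symm x)
  calc ∑ x, μ x * h x ^ 2 ≤ ∑ x, μ x * ((N + 1) * ∑ z, (h (e (z + 1)) - h (e z)) ^ 2) :=
        Finset.sum_le_sum fun x _ => mul_le_mul_of_nonneg_left (key x) (hμ x).le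
    _ = _ := by rw [← Finset.sum_mul, hμ1, one_mul]

/-- Nash inequality for the weight `μ`; the gradient is taken along the cyclic order `e`. -/
theorem nash (ha : 0 < a) (hμ : ∀ x, a / (N + 1) ≤ μ x)
    (e : Equiv.Perm (ZMod (N + 1))) {h : ZMod (N + 1) → ℝ} (h0 : ∑ x, μ x * h x = 0)
    (h1 : ∑ x, μ x * |h x| ≤ 2) :
    a / (64 * (N + 1)) * (∑ x, μ x * h x ^ 2) ^ 3 ≤
      ∑ z, (h (e (z + 1)) - h (e z)) ^ 2 := by
  have hn : (0 : ℝ) < N + 1 := by positivity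
  have hμ0 : ∀ x, 0 < μ x := fun x => (div_pos ha hn).trans_le (hμ x)
  obtain ⟨x₀, h₀⟩ := exists_nonpos_of_weighted_sum_eq_zero hμ0 h0
  obtain ⟨x₁, h₁⟩ := exists_nonpos_of_weighted_sum_eq_zero (h := fun x => -h x) hμ0
    (by simpa using h0)
  obtain ⟨y, -, hy⟩ := Finset.exists_max_image Finset.univ (fun x => |h x|)
    Finset.univ_nonempty
  have hGN : h y ^ 4 ≤ 4 * (∑ z, (h (e (z + 1)) - h (e z)) ^ 2) * ∑ z, h z ^ 2 := by
    have := pow_four_le_energy_mul_sum_sq (h := fun z => h (e z)) (x₀ := e.symm x₀)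
      (x₁ := e.symm x₁) (by simpa using h₀) (by simpa using h₁) (e.symm y)
    rwa [Equiv.apply_symm_apply, Equiv.sum_comp e fun z => h z ^ 2] at this
  set D := ∑ z, (h (e (z + 1)) - h (e z)) ^ 2 with hD
  set u := ∑ x, μ x * h x ^ 2 with hu
  have hD0 : 0 ≤ D := Finset.sum_nonneg fun _ _ => sq_nonneg _
  have hu0 : 0 ≤ u := Finset.sum_nonneg fun x _ => mul_nonneg (hμ0 x).le (sq_nonneg _)
  have hsum : a * ∑ z, h z ^ 2 ≤ (N + 1) * u := by
    rw [hu, Finset.mul_sum, Finset.mul_sum]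
    refine Finset.sum_le_sum fun x _ => ?_
    have := (div_le_iff₀ hn).1 (hμ x)
    nlinarith [mul_le_mul_of_nonneg_right this (sq_nonneg (h x))]
  have huM : u ≤ 2 * |h y| := by
    calc u ≤ ∑ x, |h y| * (μ x * |h x|) := by
          refine Finset.sum_le_sum fun x hx => ?_
          rw [← sq_abs]
          have := mul_le_mul_of_nonneg_left (hy x hx) (mul_nonneg (hμ0 x).le (abs_nonneg (h x)))
          linarith
      _ = |h y| * ∑ x, μ x * |h x| := by rw [Finset.mul_sum]
      _ ≤ |h y| * 2 := by gcongr
      _ = _ := by ring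
  -- `u ≤ 2 * ‖h‖_∞` and the Gagliardo–Nirenberg bound on `‖h‖_∞ ^ 4` close up to `u ^ 3 ≲ D`.
  have hu4 : a * u ^ 4 ≤ 64 * (N + 1) * D * u := by
    have : u ^ 4 ≤ (2 * |h y|) ^ 4 := by gcongr
    have h4 : (2 * |h y|) ^ 4 = 16 * h y ^ 4 := by
      rw [mul_pow, Even.pow_abs (by decide)]; norm_num
    calc a * u ^ 4 ≤ a * (16 * (4 * D * ∑ z, h z ^ 2)) := by
          rw [h4] at this; gcongr; linarith
      _ = 64 * D * (a * ∑ z, h z ^ 2) := by ring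
      _ ≤ 64 * D * ((N + 1) * u) := by gcongr
      _ = _ := by ring
  rcases hu0.eq_or_lt with h | h
  · rw [← h]; simpa using hD0
  · have : a * u ^ 3 ≤ 64 * (N + 1) * D :=
      le_of_mul_le_mul_right (by linarith [show a * u ^ 3 * u = a * u ^ 4 by ring]) h
    rw [div_mul_eq_mul_div, div_le_iff₀ (by positivity)]
    linarith

end Functional

/-! ### Decay of the variance -/

/-- A probability vector gives a variance at least as large as the contribution of one pair of
points. -/
theorem mul_sq_sub_le_variance {V : Type*} [Fintype V] {p : V → ℝ} (hp : ∀ y, 0 ≤ p y)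
    (hp1 : ∑ y, p y = 1) (F : V → ℝ) (y y' : V) :
    p y * p y' * (F y - F y') ^ 2 ≤ ∑ w, p w * F w ^ 2 - (∑ w, p w * F w) ^ 2 := by
  classical
  rcases eq_or_ne y y' with rfl | hne
  · have := Finset.sum_mul_sq_le_sq_mul_sq Finset.univ (fun w => √(p w))
      (fun w => √(p w) * F w)
    simp only [mul_pow, Real.sq_sqrt (hp _), ← mul_assoc, Real.mul_self_sqrt (hp _), hp1] at this
    simpa using this
  set c := ∑ w, p w * F w with hc
  have hid : ∑ w, p w * F w ^ 2 - c ^ 2 = ∑ w, p w * (F w - c) ^ 2 := by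
    have : ∀ w, p w * (F w - c) ^ 2 = p w * F w ^ 2 - 2 * c * (p w * F w) + c ^ 2 * p w :=
      fun w => by ring
    simp only [this, Finset.sum_add_distrib, Finset.sum_sub_distrib, ← Finset.mul_sum, hp1, ← hc]
    ring
  have hpair : p y * (F y - c) ^ 2 + p y' * (F y' - c) ^ 2 ≤ ∑ w, p w * (F w - c) ^ 2 := by
    rw [← Finset.sum_pair (f := fun w => p w * (F w - c) ^ 2) hne]
    exact Finset.sum_le_univ_sum_of_nonneg fun w => mul_nonneg (hp w) (sq_nonneg _)
  have hle : p y + p y' ≤ 1 := by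
    rw [← hp1, ← Finset.sum_pair hne]
    exact Finset.sum_le_univ_sum_of_nonneg hp
  rw [hid]
  refine le_trans ?_ hpair
  -- With `s = p y + p y' ≤ 1`, the left side is at most `p y * p y' / s * (F y - F y') ^ 2`, the
  -- minimum over `c` of the right side.
  have h1 := hp y
  have h2 := hp y'
  nlinarith [sq_nonneg (p y * (F y - c) + p y' * (F y' - c)),
    mul_nonneg (sub_nonneg.2 hle) (add_nonneg (mul_nonneg h1 (sq_nonneg (F y - c)))
      (mul_nonneg h2 (sq_nonneg (F y' - c))))]

/-- A sequence that obeys both the discrete Nash and the discrete Poincaré differential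
inequality reaches `1` by time `1 / (2 * t)` whatever its starting value, and decays
exponentially from there. -/
theorem le_exp_of_nash_of_poincare {u : ℕ → ℝ} {t : ℝ} (ht : 0 < t) (hu : ∀ k, 0 ≤ u k)
    (h3 : ∀ k, u (k + 1) ≤ u k - t * u k ^ 3) (h1 : ∀ k, u (k + 1) ≤ u k - t * u k)
    {k : ℕ} (hk : 1 / (2 * t) ≤ k) (j : ℕ) : u (k + j) ≤ Real.exp (-(t * j)) := by
  -- The cubic recursion makes `(u k)⁻²` grow by at least `2 * t` per step.
  have hpoly : ∀ k : ℕ, u k ^ 2 * (2 * t * k) ≤ 1 := by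
    intro k
    induction k with
    | zero => simp
    | succ k ih =>
      set w := t * u k ^ 2 with hw
      have hw0 : 0 ≤ w := by positivity
      rcases (hu k).eq_or_lt with h | h
      · have : u (k + 1) = 0 := le_antisymm (by simpa [← h] using h3 k) (hu _)
        simp [this]
      · have hstep : u (k + 1) ≤ u k * (1 - w) := (h3 k).trans_eq (by rw [hw]; ring)
        have hw1 : w ≤ 1 := by
          by_contra! hc
          nlinarith [hu (k + 1), mul_pos h (sub_pos.2 hc)]
        calc u (k + 1) ^ 2 * (2 * t * (k + 1 : ℕ))
            ≤ (u k * (1 - w)) ^ 2 * (2 * t * (k + 1 : ℕ)) := by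
              have := hu (k + 1); gcongr
          _ = (1 - w) ^ 2 * (u k ^ 2 * (2 * t * k) + 2 * w) := by
              rw [hw]; push_cast; ring
          _ ≤ (1 - w) ^ 2 * (1 + 2 * w) := by gcongr
          _ ≤ 1 := by nlinarith [mul_nonneg (sq_nonneg w) (sub_nonneg.2 hw1), sq_nonneg w]
  induction j with
  | zero =>
    have hk' : 1 ≤ 2 * t * k := by
      rw [div_le_iff₀ (by positivity)] at hk; linarith
    have : u k ^ 2 ≤ 1 := by nlinarith [hpoly k, sq_nonneg (u k)]
    simpa using (sq_le_one_iff₀ (hu k)).1 this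
  | succ j ih =>
    have hexp : Real.exp (-(t * (j + 1 : ℕ))) = Real.exp (-(t * j)) * Real.exp (-t) := by
      rw [← Real.exp_add]; congr 1; push_cast; ring
    have h2 : 1 - t ≤ Real.exp (-t) := by linarith [Real.add_one_le_exp (-t)]
    calc u (k + (j + 1)) ≤ u (k + j) * (1 - t) := (h1 (k + j)).trans_eq (by ring)
      _ ≤ u (k + j) * Real.exp (-t) := mul_le_mul_of_nonneg_left h2 (hu _)
      _ ≤ _ := by rw [hexp]; gcongr

/-- `K` is a Markov kernel with nonnegative invariant vector `μ`. -/
structure IsMarkovWith {V : Type*} [Fintype V] (K : Matrix V V ℝ) (μ : V → ℝ) : Prop where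
  nonneg : ∀ x y, 0 ≤ K x y
  row_sum : ∀ x, ∑ y, K x y = 1
  weight_nonneg : ∀ x, 0 ≤ μ x
  invariant : ∀ y, ∑ x, μ x * K x y = μ y

namespace IsMarkovWith

section General

variable {V : Type*} [Fintype V] {K : Matrix V V ℝ} {μ : V → ℝ}

theorem sum_mul_mulVec (hK : IsMarkovWith K μ) (F : V → ℝ) :
    ∑ x, μ x * (K *ᵥ F) x = ∑ x, μ x * F x := by
  simp only [Matrix.mulVec, dotProduct, Finset.mul_sum]
  rw [Finset.sum_comm]
  refine Finset.sum_congr rfl fun y _ => ?_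
  rw [← hK.invariant y, Finset.sum_mul]
  exact Finset.sum_congr rfl fun x _ => by ring

theorem sum_mul_abs_mulVec_le (hK : IsMarkovWith K μ) (F : V → ℝ) :
    ∑ x, μ x * |(K *ᵥ F) x| ≤ ∑ x, μ x * |F x| := by
  rw [← hK.sum_mul_mulVec fun x => |F x|]
  refine Finset.sum_le_sum fun x _ => mul_le_mul_of_nonneg_left ?_ (hK.weight_nonneg x)
  refine (Finset.abs_sum_le_sum_abs _ _).trans_eq (Finset.sum_congr rfl fun y _ => ?_)
  rw [abs_mul, abs_of_nonneg (hK.nonneg x y)]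

end General

variable {N : ℕ} {K : Matrix (ZMod (N + 1)) (ZMod (N + 1)) ℝ} {μ : ZMod (N + 1) → ℝ}
  {a β : ℝ} {e e' : Equiv.Perm (ZMod (N + 1))}

/-- If from each state `e' x` the kernel can move to both `e x` and `e (x + 1)`, one step lowers
the second moment by a multiple of the energy along the cyclic order `e`. -/
theorem sum_mul_mulVec_sq_le (hK : IsMarkovWith K μ) (hβ : 0 ≤ β)
    (hμ : ∀ x, a / (N + 1) ≤ μ x) (h₁ : ∀ x, β ≤ K (e' x) (e x))
    (h₂ : ∀ x, β ≤ K (e' x) (e (x + 1))) (F : ZMod (N + 1) → ℝ) :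
    ∑ x, μ x * (K *ᵥ F) x ^ 2 ≤ ∑ x, μ x * F x ^ 2
      - a * β ^ 2 / (N + 1) * ∑ z, (F (e (z + 1)) - F (e z)) ^ 2 := by
  rw [← hK.sum_mul_mulVec fun x => F x ^ 2, Finset.mul_sum,
    ← Equiv.sum_comp e' fun x => μ x * (K *ᵥ F) x ^ 2,
    ← Equiv.sum_comp e' fun x => μ x * (K *ᵥ fun x => F x ^ 2) x, ← Finset.sum_sub_distrib]
  refine Finset.sum_le_sum fun x _ => ?_
  have hv := mul_sq_sub_le_variance (hK.nonneg (e' x)) (hK.row_sum (e' x)) F (e (x + 1)) (e x)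
  have hb : β ^ 2 ≤ K (e' x) (e (x + 1)) * K (e' x) (e x) := by
    rw [sq]; exact mul_le_mul (h₂ x) (h₁ x) hβ (hK.nonneg _ _)
  have hn : (0 : ℝ) < N + 1 := by positivity
  have h3 : a / (N + 1) * (β ^ 2 * (F (e (x + 1)) - F (e x)) ^ 2) ≤
      μ (e' x) * (∑ w, K (e' x) w * F w ^ 2 - (∑ w, K (e' x) w * F w) ^ 2) := by
    refine mul_le_mul (hμ _) ((mul_le_mul_of_nonneg_right hb (sq_nonneg _)).trans hv)
      (by positivity) (hK.weight_nonneg _)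
  have h4 : a * β ^ 2 / (N + 1) * (F (e (x + 1)) - F (e x)) ^ 2 =
      a / (N + 1) * (β ^ 2 * (F (e (x + 1)) - F (e x)) ^ 2) := by ring
  simp only [Matrix.mulVec, dotProduct]
  rw [h4]
  linarith

/-- Convergence in `L²(μ)`, in a time of order `(N + 1)²` and at a rate of order `(N + 1)⁻²`,
for all initial functions in the `L¹(μ)` ball of radius `2`. -/
theorem sum_mul_pow_mulVec_sq_le (hK : IsMarkovWith K μ) (ha : 0 < a) (ha1 : a ≤ 1)
    (hβ : 0 < β) (hμ : ∀ x, a / (N + 1) ≤ μ x) (hμ1 : ∑ x, μ x = 1)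
    (h₁ : ∀ x, β ≤ K (e' x) (e x)) (h₂ : ∀ x, β ≤ K (e' x) (e (x + 1)))
    {F : ZMod (N + 1) → ℝ} (hF0 : ∑ x, μ x * F x = 0) (hF1 : ∑ x, μ x * |F x| ≤ 2)
    {t : ℝ} (ht : t = a ^ 2 * β ^ 2 / 64 / (N + 1) ^ 2) {k : ℕ} (hk : 1 / (2 * t) ≤ k) (j : ℕ) :
    ∑ x, μ x * (K ^ (k + j) *ᵥ F) x ^ 2 ≤ Real.exp (-(t * j)) := by
  have hn : (0 : ℝ) < N + 1 := by positivity
  have hμ0 : ∀ x, 0 < μ x := fun x => (div_pos ha hn).trans_le (hμ x)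
  have ht0 : 0 < t := by rw [ht]; positivity
  have hsucc : ∀ k, K ^ (k + 1) *ᵥ F = K *ᵥ (K ^ k *ᵥ F) := fun k => by
    rw [Matrix.mulVec_mulVec, pow_succ']
  have hmean : ∀ k, ∑ x, μ x * (K ^ k *ᵥ F) x = 0 := by
    intro k
    induction k with
    | zero => simpa using hF0
    | succ k ih => rw [hsucc, hK.sum_mul_mulVec, ih]
  have hL1 : ∀ k, ∑ x, μ x * |(K ^ k *ᵥ F) x| ≤ 2 := by
    intro k
    induction k with
    | zero => simpa using hF1
    | succ k ih => rw [hsucc]; exact (hK.sum_mul_abs_mulVec_le _).trans ih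
  refine le_exp_of_nash_of_poincare (u := fun k => ∑ x, μ x * (K ^ k *ᵥ F) x ^ 2) ht0
    (fun k => Finset.sum_nonneg fun x _ => mul_nonneg (hμ0 x).le (sq_nonneg _))
    (fun k => ?_) (fun k => ?_) hk j
  · simp only [hsucc]
    refine (hK.sum_mul_mulVec_sq_le hβ.le hμ h₁ h₂ _).trans (sub_le_sub_left ?_ _)
    refine le_trans (le_of_eq ?_) (mul_le_mul_of_nonneg_left
      (nash ha hμ e (hmean k) (hL1 k)) (by positivity))
    rw [ht]; field_simp
  · simp only [hsucc]
    refine (hK.sum_mul_mulVec_sq_le hβ.le hμ h₁ h₂ _).trans (sub_le_sub_left ?_ _)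
    have hp := poincare hμ0 hμ1 e (hmean k)
    have hu0 : 0 ≤ ∑ x, μ x * (K ^ k *ᵥ F) x ^ 2 :=
      Finset.sum_nonneg fun x _ => mul_nonneg (hμ0 x).le (sq_nonneg _)
    have hta : t ≤ a * β ^ 2 / (N + 1) ^ 2 := by
      rw [ht]
      gcongr
      nlinarith [mul_pos ha (pow_pos hβ 2),
        mul_le_mul_of_nonneg_right ha1 (mul_pos ha (pow_pos hβ 2)).le]
    calc t * ∑ x, μ x * (K ^ k *ᵥ F) x ^ 2
        ≤ a * β ^ 2 / (N + 1) ^ 2 * ∑ x, μ x * (K ^ k *ᵥ F) x ^ 2 := by gcongr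
      _ ≤ a * β ^ 2 / (N + 1) ^ 2 *
          ((N + 1) * ∑ z, ((K ^ k *ᵥ F) (e (z + 1)) - (K ^ k *ᵥ F) (e z)) ^ 2) := by gcongr
      _ = _ := by field_simp

end IsMarkovWith

/-! ### The perturbed walk on the cycle -/

/-- The probability under `lazyCircle N ε` of stepping from `x` to `x + 1`. -/
noncomputable def stepUp (N : ℕ) (ε : ℝ) (x : ZMod (N + 1)) : ℝ :=
  if x = 0 then (1 + ε) / (2 * (2 + ε)) else if x = 1 then 1 / (2 * (2 + ε)) else 1 / 4

/-- The probability under `lazyCircle N ε` of stepping from `x` to `x - 1`. -/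
noncomputable def stepDown (N : ℕ) (ε : ℝ) (x : ZMod (N + 1)) : ℝ :=
  if x = 0 then 1 / (2 * (2 + ε)) else if x = 1 then (1 + ε) / (2 * (2 + ε)) else 1 / 4

section Circle

variable {N : ℕ} {ε : ℝ}

theorem one_ne_zero_of_two_le (hN : 2 ≤ N) : (1 : ZMod (N + 1)) ≠ 0 := by
  intro h
  have := (ZMod.natCast_eq_zero_iff 1 (N + 1)).1 (by exact_mod_cast h)
  have := Nat.le_of_dvd one_pos this
  omega

theorem two_ne_zero_of_two_le (hN : 2 ≤ N) : (2 : ZMod (N + 1)) ≠ 0 := by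
  intro h
  have := (ZMod.natCast_eq_zero_iff 2 (N + 1)).1 (by exact_mod_cast h)
  have := Nat.le_of_dvd two_pos this
  omega

theorem lazyCircle_apply (hN : 2 ≤ N) (x y : ZMod (N + 1)) :
    lazyCircle N ε x y = (if y = x then 1 / 2 else 0) +
      (if y = x + 1 then stepUp N ε x else 0) + (if y = x - 1 then stepDown N ε x else 0) := by
  have h1 := one_ne_zero_of_two_le hN
  have h2 := two_ne_zero_of_two_le hN
  have e1 : x ≠ x + 1 := fun h => h1 (by linear_combination -h)
  have e2 : x ≠ x - 1 := fun h => h1 (by linear_combination h)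
  have e3 : x + 1 ≠ x - 1 := fun h => h2 (by linear_combination h)
  unfold lazyCircle stepUp stepDown
  by_cases hxy : y = x
  · subst hxy; simp [e1, e2]
  rw [if_neg (Ne.symm hxy), if_neg hxy]
  by_cases hup : y = x + 1
  · subst hup
    by_cases hx0 : x = 0
    · subst hx0
      have : (1 : ZMod (N + 1)) ≠ -1 := fun h => h2 (by linear_combination h)
      simp [h1, this]
    by_cases hx1 : x = 1
    · subst hx1
      have : (1 : ZMod (N + 1)) + 1 = 2 := by norm_num
      simp [h1, h2, this]
    simp [hx0, hx1, e3]
  by_cases hdn : y = x - 1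
  · subst hdn
    by_cases hx0 : x = 0
    · subst hx0
      have : (-1 : ZMod (N + 1)) ≠ 1 := fun h => h2 (by linear_combination -h)
      simp [this, h1.symm]
    by_cases hx1 : x = 1
    · subst hx1
      have : (0 : ZMod (N + 1)) ≠ 1 + 1 := fun h => h2 (by linear_combination -h)
      simp [h1, this]
    simp [hx0, hx1, e3.symm]
  have hA : ¬ (x = 0 ∧ y = 1 ∨ x = 1 ∧ y = 0) := by
    rintro (⟨rfl, rfl⟩ | ⟨rfl, rfl⟩)
    · exact hup (by simp)
    · exact hdn (by simp)
  have hB : ¬ (x = 0 ∧ y = -1 ∨ x = 1 ∧ y = 2) := by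
    rintro (⟨rfl, rfl⟩ | ⟨rfl, rfl⟩)
    · exact hdn (by simp)
    · exact hup (by norm_num)
  simp [hup, hdn, hA, hB]

theorem lightStep_le_quarter (hε : 0 < ε) : 1 / (2 * (2 + ε)) ≤ 1 / 4 := by
  rw [div_le_div_iff₀ (by positivity) (by positivity)]; linarith

theorem quarter_le_heavyStep (hε : 0 < ε) : 1 / 4 ≤ (1 + ε) / (2 * (2 + ε)) := by
  rw [div_le_div_iff₀ (by positivity) (by positivity)]; linarith

theorem light_add_heavy (hε : 0 < ε) :
    1 / (2 * (2 + ε)) + (1 + ε) / (2 * (2 + ε)) = 1 / 2 := by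
  field_simp; ring

theorem lightStep_le_stepUp (hε : 0 < ε) (x : ZMod (N + 1)) :
    1 / (2 * (2 + ε)) ≤ stepUp N ε x := by
  have := lightStep_le_quarter hε
  have := quarter_le_heavyStep hε
  unfold stepUp; split_ifs <;> linarith

theorem lightStep_le_stepDown (hε : 0 < ε) (x : ZMod (N + 1)) :
    1 / (2 * (2 + ε)) ≤ stepDown N ε x := by
  have := lightStep_le_quarter hε
  have := quarter_le_heavyStep hε
  unfold stepDown; split_ifs <;> linarith

theorem stepUp_pos (hε : 0 < ε) (x : ZMod (N + 1)) : 0 < stepUp N ε x :=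
  lt_of_lt_of_le (by positivity) (lightStep_le_stepUp hε x)

theorem stepDown_pos (hε : 0 < ε) (x : ZMod (N + 1)) : 0 < stepDown N ε x :=
  lt_of_lt_of_le (by positivity) (lightStep_le_stepDown hε x)

theorem stepUp_add_stepDown (hε : 0 < ε) (x : ZMod (N + 1)) :
    stepUp N ε x + stepDown N ε x = 1 / 2 := by
  have := light_add_heavy hε
  unfold stepUp stepDown; split_ifs <;> linarith

theorem lazyCircle_nonneg (hN : 2 ≤ N) (hε : 0 < ε) (x y : ZMod (N + 1)) :
    0 ≤ lazyCircle N ε x y := by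
  have := stepUp_pos hε x
  have := stepDown_pos hε x
  rw [lazyCircle_apply hN]
  split_ifs <;> positivity

theorem lazyCircle_row_sum (hN : 2 ≤ N) (hε : 0 < ε) (x : ZMod (N + 1)) :
    ∑ y, lazyCircle N ε x y = 1 := by
  simp only [lazyCircle_apply hN, Finset.sum_add_distrib, Finset.sum_ite_eq', Finset.mem_univ,
    if_true]
  linarith [stepUp_add_stepDown hε x]

theorem lazyCircle_self (x : ZMod (N + 1)) : lazyCircle N ε x x = 1 / 2 := by
  simp [lazyCircle]

theorem lightStep_le_lazyCircle_up (hN : 2 ≤ N) (hε : 0 < ε) (x : ZMod (N + 1)) :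
    1 / (2 * (2 + ε)) ≤ lazyCircle N ε x (x + 1) := by
  have := (stepDown_pos hε x).le
  have := lightStep_le_stepUp hε x
  rw [lazyCircle_apply hN, if_pos rfl]
  split_ifs <;> linarith

theorem lightStep_le_lazyCircle_down (hN : 2 ≤ N) (hε : 0 < ε) (x : ZMod (N + 1)) :
    1 / (2 * (2 + ε)) ≤ lazyCircle N ε (x + 1) x := by
  have := (stepUp_pos hε (x + 1)).le
  have := lightStep_le_stepDown hε (x + 1)
  rw [lazyCircle_apply hN, add_sub_cancel_right, if_pos (rfl : x = x)]
  split_ifs <;> linarith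

theorem sum_mul_lazyCircle (hN : 2 ≤ N) (f : ZMod (N + 1) → ℝ) (z : ZMod (N + 1)) :
    ∑ x, f x * lazyCircle N ε x z =
      f z / 2 + f (z - 1) * stepUp N ε (z - 1) + f (z + 1) * stepDown N ε (z + 1) := by
  have h1 : ∀ x, z = x + 1 ↔ z - 1 = x := fun x => sub_eq_iff_eq_add.symm
  have h2 : ∀ x, z = x - 1 ↔ z + 1 = x := fun x => eq_sub_iff_add_eq
  simp only [lazyCircle_apply hN, mul_add, Finset.sum_add_distrib, mul_ite, mul_zero, h1, h2,
    Finset.sum_ite_eq, Finset.mem_univ, if_true]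
  ring

/-! ### Invariant vectors of the rearranged kernel -/

theorem vecMul_tilde_apply {V : Type*} [Fintype V] (K : Matrix V V ℝ) (g : Equiv.Perm V)
    (f : V → ℝ) (z : V) : (f ᵥ* tilde K g) (g z) = ∑ x, f x * K x z := by
  simp [Matrix.vecMul, dotProduct, tilde]

theorem apply_of_vecMul_tilde_eq (hN : 2 ≤ N) {g : Equiv.Perm (ZMod (N + 1))}
    {f : ZMod (N + 1) → ℝ} (hf : f ᵥ* tilde (lazyCircle N ε) g = f) (z : ZMod (N + 1)) :
    f (g z) = f z / 2 + f (z - 1) * stepUp N ε (z - 1) + f (z + 1) * stepDown N ε (z + 1) := by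
  conv_lhs => rw [← hf]
  rw [vecMul_tilde_apply, sum_mul_lazyCircle hN]

/-- Irreducibility of the rearranged kernel: the preimage of `S` under `g` lies in `S`, hence
equals `S`, so `S` is stable under the rotation by `-1`. -/
theorem forall_of_perm_closed {S : ZMod (N + 1) → Prop} (g : Equiv.Perm (ZMod (N + 1)))
    (hS : ∀ z, S (g z) → S z ∧ S (z - 1)) {x : ZMod (N + 1)} (hx : S x) (z : ZMod (N + 1)) :
    S z := by
  classical
  have hinv : ∀ z, S z → S (g.symm z) := fun z hz => (hS (g.symm z) (by simpa using hz)).1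
  have hfwd : ∀ z, S z → S (g z) := fun z hz => by
    simpa using Equiv.Perm.perm_symm_mapsTo_of_mapsTo (s := {z | S z}) g.symm hinv hz
  have hdown : ∀ k : ℕ, S (x - k) := by
    intro k
    induction k with
    | zero => simpa using hx
    | succ k ih =>
      rw [Nat.cast_succ, ← sub_sub]
      exact (hS _ (hfwd _ ih)).2
  simpa using hdown (x - z).val

theorem eq_zero_of_invariant_of_exists_zero (hN : 2 ≤ N) (hε : 0 < ε)
    {g : Equiv.Perm (ZMod (N + 1))} {f : ZMod (N + 1) → ℝ}
    (hf : f ᵥ* tilde (lazyCircle N ε) g = f) (hf0 : ∀ x, 0 ≤ f x) {x : ZMod (N + 1)}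
    (hx : f x = 0) : ∀ z, f z = 0 := by
  refine forall_of_perm_closed (S := fun z => f z = 0) g (fun z hz => ?_) hx
  rw [apply_of_vecMul_tilde_eq hN hf] at hz
  have h1 := hf0 z
  have h2 := mul_nonneg (hf0 (z - 1)) (stepUp_pos hε (z - 1)).le
  have h3 := mul_nonneg (hf0 (z + 1)) (stepDown_pos hε (z + 1)).le
  refine ⟨by linarith, ?_⟩
  have : f (z - 1) * stepUp N ε (z - 1) = 0 := by linarith
  exact (mul_eq_zero.1 this).resolve_right (stepUp_pos hε _).ne'

/-- A stochastic matrix has an invariant probability: it has a left eigenvector `v` for the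
eigenvalue `1`, and `|v|` is one as well because the total mass is preserved. -/
theorem exists_isInvariantProb {V : Type*} [Fintype V] [DecidableEq V] [Nonempty V]
    {K : Matrix V V ℝ} (h0 : ∀ x y, 0 ≤ K x y) (h1 : ∀ x, ∑ y, K x y = 1) :
    ∃ π, IsInvariantProb K π := by
  have hdet : (K - 1).det = 0 := by
    refine Matrix.exists_mulVec_eq_zero_iff.1 ⟨fun _ => 1, ?_, ?_⟩
    · exact fun h => one_ne_zero (congrFun h (Classical.arbitrary V))
    · rw [Matrix.sub_mulVec, Matrix.one_mulVec, sub_eq_zero]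
      ext x
      simpa [Matrix.mulVec, dotProduct] using h1 x
  obtain ⟨v, hv0, hv⟩ := Matrix.exists_vecMul_eq_zero_iff.2 hdet
  rw [Matrix.vecMul_sub, Matrix.vecMul_one, sub_eq_zero] at hv
  have hle : ∀ y, |v y| ≤ ∑ x, |v x| * K x y := fun y => by
    conv_lhs => rw [← hv]
    refine (Finset.abs_sum_le_sum_abs _ _).trans_eq (Finset.sum_congr rfl fun x _ => ?_)
    rw [abs_mul, abs_of_nonneg (h0 x y)]
  have hsum : ∑ y, |v y| = ∑ y, ∑ x, |v x| * K x y := by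
    rw [Finset.sum_comm]
    simp [← Finset.mul_sum, h1]
  have heq : ∀ y, |v y| = ∑ x, |v x| * K x y := fun y =>
    (Finset.sum_eq_sum_iff_of_le fun y _ => hle y).1 hsum y (Finset.mem_univ y)
  have hpos : 0 < ∑ x, |v x| := by
    obtain ⟨x, hx⟩ := Function.ne_iff.1 hv0
    exact Finset.sum_pos' (fun _ _ => abs_nonneg _) ⟨x, Finset.mem_univ x, abs_pos.2 hx⟩
  refine ⟨fun x => |v x| / ∑ y, |v y|, fun x => by positivity, ?_, ?_⟩
  · rw [← Finset.sum_div, div_self hpos.ne']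
  · ext y
    simp only [Matrix.vecMul, dotProduct]
    conv_rhs => rw [heq y]
    rw [Finset.sum_div]
    exact Finset.sum_congr rfl fun x _ => by ring

theorem tilde_nonneg (hN : 2 ≤ N) (hε : 0 < ε) (g : Equiv.Perm (ZMod (N + 1)))
    (x y : ZMod (N + 1)) : 0 ≤ tilde (lazyCircle N ε) g x y :=
  lazyCircle_nonneg hN hε _ _

theorem tilde_row_sum (hN : 2 ≤ N) (hε : 0 < ε) (g : Equiv.Perm (ZMod (N + 1)))
    (x : ZMod (N + 1)) : ∑ y, tilde (lazyCircle N ε) g x y = 1 :=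
  (Equiv.sum_comp g⁻¹ (lazyCircle N ε x)).trans (lazyCircle_row_sum hN hε x)

theorem IsInvariantProb.pos (hN : 2 ≤ N) (hε : 0 < ε) {g : Equiv.Perm (ZMod (N + 1))}
    {π : ZMod (N + 1) → ℝ} (hπ : IsInvariantProb (tilde (lazyCircle N ε) g) π)
    (x : ZMod (N + 1)) : 0 < π x := by
  refine (hπ.1 x).lt_of_ne fun h => ?_
  have := eq_zero_of_invariant_of_exists_zero hN hε hπ.2.2 hπ.1 h.symm
  have h1 := hπ.2.1
  simp [this] at h1

/-- Uniqueness: the largest multiple of `π` below `π'` touches `π'`, hence equals it. -/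
theorem IsInvariantProb.unique (hN : 2 ≤ N) (hε : 0 < ε) {g : Equiv.Perm (ZMod (N + 1))}
    {π π' : ZMod (N + 1) → ℝ} (hπ : IsInvariantProb (tilde (lazyCircle N ε) g) π)
    (hπ' : IsInvariantProb (tilde (lazyCircle N ε) g) π') : π' = π := by
  have hpos := hπ.pos hN hε
  obtain ⟨x, -, hx⟩ := Finset.exists_min_image Finset.univ (fun x => π' x / π x)
    Finset.univ_nonempty
  set c := π' x / π x with hc
  have hinv : (π' - c • π) ᵥ* tilde (lazyCircle N ε) g = π' - c • π := by
    rw [Matrix.sub_vecMul, Matrix.smul_vecMul, hπ.2.2, hπ'.2.2]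
  have hzero := eq_zero_of_invariant_of_exists_zero hN hε hinv
    (fun y => by
      have := (le_div_iff₀ (hpos y)).1 (hx y (Finset.mem_univ y))
      simpa using this)
    (x := x) (by simp [hc, div_mul_cancel₀ _ (hpos x).ne'])
  have heq : ∀ y, π' y = c * π y := fun y => by
    have := hzero y
    simpa [sub_eq_zero] using this
  have hc1 : c = 1 := by
    have h := hπ'.2.1
    simp only [heq, ← Finset.mul_sum, hπ.2.1, mul_one] at h
    exact h
  ext y
  rw [heq, hc1, one_mul]

/-! ### The oscillation of the invariant probability -/

/-- The maximum of an invariant vector is produced at one of the two vertices that receive mass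
through the heavy edge: elsewhere the kernel only averages. -/
theorem exists_max_at_heavy (hN : 2 ≤ N) (hε : 0 < ε) {g : Equiv.Perm (ZMod (N + 1))}
    {f : ZMod (N + 1) → ℝ} (hf : f ᵥ* tilde (lazyCircle N ε) g = f) (hpos : ∀ x, 0 < f x)
    {x : ZMod (N + 1)} (hx : ∀ y, f y ≤ f x) : f (g 0) = f x ∨ f (g 1) = f x := by
  by_contra! hc
  refine hc.1 (forall_of_perm_closed (S := fun z => f z = f x) g (fun z hz => ?_) rfl _)
  have h0 : z ≠ 0 := fun h => hc.1 (h ▸ hz)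
  have h1 : z ≠ 1 := fun h => hc.2 (h ▸ hz)
  rw [apply_of_vecMul_tilde_eq hN hf] at hz
  have hq := lightStep_le_quarter hε
  have hup : stepUp N ε (z - 1) ≤ 1 / 4 := by
    rw [stepUp, if_neg (sub_ne_zero.2 h1)]; split_ifs <;> linarith
  have hdn : stepDown N ε (z + 1) ≤ 1 / 4 := by
    have : z + 1 ≠ 1 := fun h => h0 (by simpa using h)
    rw [stepDown]; simp only [this, if_false]; split_ifs <;> linarith
  have a1 := mul_le_mul_of_nonneg_left hup (hpos (z - 1)).le
  have a2 := mul_le_mul_of_nonneg_left hdn (hpos (z + 1)).le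
  have b0 := hx z
  have b1 := hx (z - 1)
  have b2 := hx (z + 1)
  constructor <;> linarith

/-- The minimum of an invariant vector is produced at an outer neighbour of the heavy edge. -/
theorem exists_min_at_light (hN : 2 ≤ N) (hε : 0 < ε) {g : Equiv.Perm (ZMod (N + 1))}
    {f : ZMod (N + 1) → ℝ} (hf : f ᵥ* tilde (lazyCircle N ε) g = f) (hpos : ∀ x, 0 < f x)
    {x : ZMod (N + 1)} (hx : ∀ y, f x ≤ f y) : f (g (-1)) = f x ∨ f (g 2) = f x := by
  by_contra! hc
  refine hc.1 (forall_of_perm_closed (S := fun z => f z = f x) g (fun z hz => ?_) rfl _)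
  have h0 : z ≠ -1 := fun h => hc.1 (h ▸ hz)
  have h1 : z ≠ 2 := fun h => hc.2 (h ▸ hz)
  rw [apply_of_vecMul_tilde_eq hN hf] at hz
  have hq := quarter_le_heavyStep hε
  have hup : 1 / 4 ≤ stepUp N ε (z - 1) := by
    have : z - 1 ≠ 1 := fun h => h1 (by linear_combination h)
    rw [stepUp]; simp only [this, if_false]; split_ifs <;> linarith
  have hdn : 1 / 4 ≤ stepDown N ε (z + 1) := by
    have : z + 1 ≠ 0 := fun h => h0 (by linear_combination h)
    rw [stepDown, if_neg this]; split_ifs <;> linarith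
  have a1 := mul_le_mul_of_nonneg_left hup (hpos (z - 1)).le
  have a2 := mul_le_mul_of_nonneg_left hdn (hpos (z + 1)).le
  have b0 := hx z
  have b1 := hx (z - 1)
  have b2 := hx (z + 1)
  constructor <;> linarith

/-- The arithmetic behind the oscillation bound: `A` and `B` are the masses at the two ends of
the heavy edge, the first hypothesis is the balance at the vertex producing the maximum `M`, the
last one the balance at the vertex producing the minimum `m`. -/
theorem le_one_add_mul_of_balance (hε : 0 < ε) {M m A B : ℝ} (hM : 0 ≤ M) (hA : A ≤ M)
    (hB : B ≤ M) (hmax : 3 / 4 * M ≤ A / 2 + B * ((1 + ε) / (2 * (2 + ε))))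
    (hmin : A * (1 / (2 * (2 + ε))) ≤ m / 4 ∨ B * (1 / (2 * (2 + ε))) ≤ m / 4) :
    M ≤ (1 + ε) * m := by
  have h2 : 0 < 2 * (2 + ε) := by positivity
  rw [← mul_div_assoc, ← sub_le_iff_le_add', le_div_iff₀ h2] at hmax
  simp only [mul_one_div, div_le_iff₀ h2] at hmin
  rcases hmin with h | h
  · have k1 : A * 2 * (2 + ε) ≥ M * (4 + ε) := by nlinarith
    have k2 : M * (4 + ε) ≤ m * (2 + ε) ^ 2 := by nlinarith
    have k3 : 0 ≤ m := by
      by_contra! hc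
      nlinarith [mul_neg_of_neg_of_pos hc (pow_pos (by linarith : 0 < 2 + ε) 2),
        mul_nonneg hM (by linarith : 0 ≤ 4 + ε)]
    have k4 : M * (4 + ε) ≤ (1 + ε) * m * (4 + ε) := by nlinarith
    exact le_of_mul_le_mul_right k4 (by linarith)
  · have k1 : M * (2 + ε) ≤ 2 * B * (1 + ε) := by nlinarith
    have k2 : 2 * B ≤ m * (2 + ε) := by linarith
    have k3 : M * (2 + ε) ≤ (1 + ε) * m * (2 + ε) := by nlinarith
    exact le_of_mul_le_mul_right k3 (by linarith)

theorem IsInvariantProb.le_one_add_mul (hN : 2 ≤ N) (hε : 0 < ε)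
    {g : Equiv.Perm (ZMod (N + 1))} {π : ZMod (N + 1) → ℝ}
    (hπ : IsInvariantProb (tilde (lazyCircle N ε) g) π) (x y : ZMod (N + 1)) :
    π x ≤ (1 + ε) * π y := by
  have hpos := hπ.pos hN hε
  obtain ⟨u, -, hu⟩ := Finset.exists_max_image Finset.univ π Finset.univ_nonempty
  obtain ⟨v, -, hv⟩ := Finset.exists_min_image Finset.univ π Finset.univ_nonempty
  replace hu : ∀ z, π z ≤ π u := fun z => hu z (Finset.mem_univ z)
  replace hv : ∀ z, π v ≤ π z := fun z => hv z (Finset.mem_univ z)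
  suffices π u ≤ (1 + ε) * π v from (hu x).trans (this.trans (by gcongr; exact hv y))
  have h1 := one_ne_zero_of_two_le hN
  have h2 := two_ne_zero_of_two_le hN
  have hb : 0 < 1 / (2 * (2 + ε)) := by positivity
  have bal := apply_of_vecMul_tilde_eq hN hπ.2.2
  -- If `N = 2` the vertices `-1` and `2` coincide and receive mass from both ends of the heavy
  -- edge through light edges; one of the two contributions is at most half the total.
  have hmin : π 0 * (1 / (2 * (2 + ε))) ≤ π v / 4 ∨ π 1 * (1 / (2 * (2 + ε))) ≤ π v / 4 := by
    have v0 := hv 2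
    have v1 := hv (-1)
    rcases exists_min_at_light hN hε hπ.2.2 hpos hv with h | h
    · rw [bal] at h
      have e0 : stepDown N ε (-1 + 1) = 1 / (2 * (2 + ε)) := by simp [stepDown]
      rw [e0, neg_add_cancel] at h
      by_cases h3 : (-1 - 1 : ZMod (N + 1)) = 1
      · have e1 : stepUp N ε (-1 - 1) = 1 / (2 * (2 + ε)) := by
          rw [h3, stepUp, if_neg h1, if_pos rfl]
        rw [e1, h3] at h
        by_contra! hc
        linarith [hc.1, hc.2]
      · have e1 : stepUp N ε (-1 - 1) = 1 / 4 := by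
          have : (-1 - 1 : ZMod (N + 1)) ≠ 0 := fun h => h2 (by linear_combination -h)
          rw [stepUp, if_neg this, if_neg h3]
        rw [e1] at h
        have := hv (-1 - 1)
        generalize π (-1 - 1) = q at h this
        left; linarith
    · rw [bal] at h
      have e0 : (2 - 1 : ZMod (N + 1)) = 1 := by norm_num
      have e1 : stepUp N ε 1 = 1 / (2 * (2 + ε)) := by simp [stepUp, h1]
      rw [e0, e1] at h
      by_cases h3 : (2 + 1 : ZMod (N + 1)) = 0
      · have e2 : stepDown N ε 0 = 1 / (2 * (2 + ε)) := by simp [stepDown]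
        rw [h3, e2] at h
        by_contra! hc
        linarith [hc.1, hc.2]
      · have e2 : stepDown N ε (2 + 1) = 1 / 4 := by
          have : (2 + 1 : ZMod (N + 1)) ≠ 1 := fun h => h2 (by linear_combination h)
          rw [stepDown, if_neg h3, if_neg this]
        rw [e2] at h
        have := hv (2 + 1)
        generalize π (2 + 1) = q at h this
        right; linarith
  rcases exists_max_at_heavy hN hε hπ.2.2 hpos hu with h | h
  · rw [bal] at h
    have e0 : stepUp N ε (0 - 1) = 1 / 4 := by
      have : (-1 : ZMod (N + 1)) ≠ 1 := fun h => h2 (by linear_combination -h)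
      simp [stepUp, h1, this]
    have e1 : stepDown N ε (0 + 1) = (1 + ε) / (2 * (2 + ε)) := by simp [stepDown, h1]
    rw [e0, e1, zero_add] at h
    have := hu (0 - 1)
    generalize π (0 - 1) = q at h this
    exact le_one_add_mul_of_balance hε (hpos u).le (hu 0) (hu 1) (by linarith) hmin
  · rw [bal] at h
    have e0 : stepUp N ε (1 - 1) = (1 + ε) / (2 * (2 + ε)) := by simp [stepUp]
    have e1 : stepDown N ε (1 + 1) = 1 / 4 := by
      have h3 : (1 + 1 : ZMod (N + 1)) ≠ 0 := fun h => h2 (by linear_combination h)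
      simp [stepDown, h1, h3]
    rw [e0, e1, sub_self] at h
    have := hu (1 + 1)
    generalize π (1 + 1) = q at h this
    exact le_one_add_mul_of_balance hε (hpos u).le (hu 1) (hu 0) (by linarith) hmin.symm

end Circle

/-! ### Merging -/

/-- The time reversal of `K` with respect to the weight `μ`, that is, the adjoint of `K` on
`L²(μ)`. -/
noncomputable def timeReversal {V : Type*} (K : Matrix V V ℝ) (μ : V → ℝ) : Matrix V V ℝ :=
  fun z x => μ x * K x z / μ z

section TimeReversal

variable {V : Type*} [Fintype V] {K : Matrix V V ℝ} {μ : V → ℝ}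

theorem IsMarkovWith.reversed (hK : IsMarkovWith K μ) (hμ : ∀ x, 0 < μ x) :
    IsMarkovWith (timeReversal K μ) μ where
  nonneg z x := div_nonneg (mul_nonneg (hμ x).le (hK.nonneg x z)) (hμ z).le
  row_sum z := by
    simp only [timeReversal]
    rw [← Finset.sum_div, hK.invariant, div_self (hμ z).ne']
  weight_nonneg x := (hμ x).le
  invariant x := by
    have : ∀ z, μ z * timeReversal K μ z x = μ x * K x z := fun z => by
      rw [timeReversal, mul_div_cancel₀ _ (hμ z).ne']
    simp only [this, ← Finset.mul_sum, hK.row_sum, mul_one]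

theorem timeReversal_pow [DecidableEq V] (hμ : ∀ x, 0 < μ x) (k : ℕ) (x z : V) :
    (timeReversal K μ ^ k) z x = μ x * (K ^ k) x z / μ z := by
  induction k generalizing x with
  | zero =>
    rcases eq_or_ne x z with rfl | h
    · simp [(hμ x).ne']
    · simp [h, h.symm]
  | succ k ih =>
    rw [pow_succ, pow_succ', Matrix.mul_apply, Matrix.mul_apply, Finset.mul_sum, Finset.sum_div]
    refine Finset.sum_congr rfl fun w _ => ?_
    have := (hμ w).ne'
    rw [ih, timeReversal]
    field_simp

theorem IsMarkovWith.pow_row_sum [DecidableEq V] (hK : IsMarkovWith K μ) (k : ℕ) (x : V) :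
    ∑ y, (K ^ k) x y = 1 := by
  induction k generalizing x with
  | zero => simp [Matrix.one_apply]
  | succ k ih =>
    simp only [pow_succ', Matrix.mul_apply]
    rw [Finset.sum_comm]
    simp only [← Finset.mul_sum, ih, mul_one, hK.row_sum]

theorem IsMarkovWith.pow_mulVec_one [DecidableEq V] (hK : IsMarkovWith K μ) (k : ℕ) :
    K ^ k *ᵥ (fun _ => (1 : ℝ)) = fun _ => 1 := by
  ext x
  simpa [Matrix.mulVec, dotProduct] using hK.pow_row_sum k x

end TimeReversal

/-- The density with respect to `μ` of the point mass at `z`, minus `1`. -/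
noncomputable def centeredDelta {V : Type*} [DecidableEq V] (μ : V → ℝ) (z : V) : V → ℝ :=
  Pi.single z (μ z)⁻¹ - fun _ => 1

section CenteredDelta

variable {V : Type*} [Fintype V] [DecidableEq V] {K : Matrix V V ℝ} {μ : V → ℝ}

theorem sum_mul_centeredDelta (hμ : ∀ x, 0 < μ x) (hμ1 : ∑ x, μ x = 1) (z : V) :
    ∑ x, μ x * centeredDelta μ z x = 0 := by
  simp [centeredDelta, mul_sub, Finset.sum_sub_distrib, hμ1, Pi.single_apply, (hμ z).ne']

theorem sum_mul_abs_centeredDelta_le (hμ : ∀ x, 0 < μ x) (hμ1 : ∑ x, μ x = 1) (z : V) :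
    ∑ x, μ x * |centeredDelta μ z x| ≤ 2 := by
  have h0 : ∀ x, 0 ≤ (Pi.single z (μ z)⁻¹ : V → ℝ) x := fun x => by
    rw [Pi.single_apply]; split_ifs
    · exact inv_nonneg.2 (hμ z).le
    · exact le_rfl
  calc ∑ x, μ x * |centeredDelta μ z x|
      ≤ ∑ x, (μ x * (Pi.single z (μ z)⁻¹ : V → ℝ) x + μ x) := by
        refine Finset.sum_le_sum fun x _ => ?_
        have : |centeredDelta μ z x| ≤ (Pi.single z (μ z)⁻¹ : V → ℝ) x + 1 := by
          refine (abs_sub _ _).trans ?_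
          rw [abs_of_nonneg (h0 x), abs_one]
        nlinarith [hμ x]
    _ = 2 := by
        simp [Finset.sum_add_distrib, hμ1, Pi.single_apply, (hμ z).ne']; norm_num

theorem IsMarkovWith.pow_mulVec_centeredDelta (hK : IsMarkovWith K μ) (k : ℕ) (x z : V) :
    (K ^ k *ᵥ centeredDelta μ z) x = (K ^ k) x z / μ z - 1 := by
  rw [centeredDelta, Matrix.mulVec_sub, hK.pow_mulVec_one]
  simp [div_eq_mul_inv]

/-- The relative error of `K ^ (2 * k)` factors through `L²(μ)`, into a function evolved by `K`
and a density evolved by the time reversal of `K`. -/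
theorem IsMarkovWith.sq_relative_error_le (hK : IsMarkovWith K μ) (hμ : ∀ x, 0 < μ x)
    (hμ1 : ∑ x, μ x = 1) (k : ℕ) (x z : V) :
    ((K ^ (k + k)) x z / μ z - 1) ^ 2 ≤
      (∑ w, μ w * (timeReversal K μ ^ k *ᵥ centeredDelta μ x) w ^ 2) *
        ∑ w, μ w * (K ^ k *ᵥ centeredDelta μ z) w ^ 2 := by
  have hR := hK.reversed hμ
  have hmean : ∑ w, μ w * (timeReversal K μ ^ k *ᵥ centeredDelta μ x) w = 0 := by
    have : ∀ w, μ w * (timeReversal K μ ^ k *ᵥ centeredDelta μ x) w = (K ^ k) x w - μ w :=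
      fun w => by
        have h1 := (hμ w).ne'
        have h2 := (hμ x).ne'
        rw [hR.pow_mulVec_centeredDelta, timeReversal_pow hμ]
        field_simp
    simp [this, Finset.sum_sub_distrib, hμ1, hK.pow_row_sum]
  have hid : (K ^ (k + k)) x z / μ z - 1 =
      ∑ w, (√(μ w) * (timeReversal K μ ^ k *ᵥ centeredDelta μ x) w) *
        (√(μ w) * (K ^ k *ᵥ centeredDelta μ z) w) := by
    have h3 : ∀ w, (√(μ w) * (timeReversal K μ ^ k *ᵥ centeredDelta μ x) w) *
        (√(μ w) * (K ^ k *ᵥ centeredDelta μ z) w) =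
        (K ^ k) x w * (K ^ k) w z / μ z - μ w * ((K ^ k) w z / μ z)
          - μ w * (timeReversal K μ ^ k *ᵥ centeredDelta μ x) w := fun w => by
      have h1 := (hμ w).ne'
      have h2 := (hμ x).ne'
      rw [mul_mul_mul_comm, Real.mul_self_sqrt (hμ w).le, hR.pow_mulVec_centeredDelta,
        timeReversal_pow hμ, hK.pow_mulVec_centeredDelta]
      field_simp
    have hinv : ∑ w, μ w * ((K ^ k) w z / μ z) = 1 := by
      have := hR.pow_row_sum k z
      simp only [timeReversal_pow hμ] at this
      simpa only [mul_div_assoc] using this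
    simp only [h3, Finset.sum_sub_distrib, hmean, hinv, sub_zero]
    rw [pow_add, Matrix.mul_apply, Finset.sum_div]
  rw [hid]
  refine (Finset.sum_mul_sq_le_sq_mul_sq _ _ _).trans_eq ?_
  simp only [mul_pow, Real.sq_sqrt (hμ _).le]

end CenteredDelta

/-- The iterated kernel of the shifted sequence is a power of the rearranged kernel, up to a
relabelling of the target. -/
theorem iterKernel_shifted_apply {V : Type*} [Fintype V] [DecidableEq V] (K : Matrix V V ℝ)
    (g : Equiv.Perm V) (n : ℕ) (x z : V) :
    iterKernel (shifted K g) n x z = (tilde K g ^ n) x ((g ^ n) z) := by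
  induction n generalizing z with
  | zero => simp [iterKernel]
  | succ n ih =>
    rw [iterKernel, Matrix.mul_apply, pow_succ, Matrix.mul_apply,
      ← Equiv.sum_comp (g ^ n) fun w => (tilde K g ^ n) x w * tilde K g w ((g ^ (n + 1)) z)]
    refine Finset.sum_congr rfl fun w _ => ?_
    rw [ih]
    simp [shifted, tilde, pow_succ']

theorem abs_div_sub_one_le {A B δ : ℝ} (hδ : δ ≤ 1 / 2) (hA : |A - 1| ≤ δ) (hB : |B - 1| ≤ δ) :
    B ≠ 0 ∧ |A / B - 1| ≤ 4 * δ := by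
  obtain ⟨a1, a2⟩ := abs_le.1 hA
  obtain ⟨b1, b2⟩ := abs_le.1 hB
  have hB0 : 0 < B := by linarith
  refine ⟨hB0.ne', ?_⟩
  rw [div_sub_one hB0.ne', abs_div, abs_of_pos hB0, div_le_iff₀ hB0]
  have : |A - B| ≤ 2 * δ := abs_le.2 ⟨by linarith, by linarith⟩
  nlinarith

theorem exists_mergingTime_eq_of_relative_error {V : Type*} [Fintype V] [DecidableEq V]
    {K : Matrix V V ℝ} {g : Equiv.Perm V} {μ : V → ℝ} {n : ℕ} {η δ : ℝ} (hη : 0 < η)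
    (hδ : δ ≤ 1 / 2) (hδη : 4 * δ ≤ η / 2)
    (hK : ∀ x z, |(tilde K g ^ n) x z / μ z - 1| ≤ δ) :
    ∃ T : ℕ, mergingTime (shifted K g) η = (T : ℕ∞) ∧ T ≤ n := by
  have hle : mergingTime (shifted K g) η ≤ n := by
    refine iInf₂_le n (lt_of_le_of_lt (b := ENNReal.ofReal (η / 2)) ?_
      ((ENNReal.ofReal_lt_ofReal_iff hη).2 (by linarith)))
    refine iSup_le fun x => iSup_le fun y => iSup_le fun z => ?_
    have hz := abs_div_sub_one_le hδ (hK x ((g ^ n) z)) (hK y ((g ^ n) z))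
    -- The bound excludes zeros of `μ` and of the kernel, where the quotients would be `0`.
    have hμz : μ ((g ^ n) z) ≠ 0 := fun h => by simp [h] at hz
    rw [div_div_div_cancel_right₀ hμz] at hz
    have hne : (tilde K g ^ n) y ((g ^ n) z) ≠ 0 := fun h => by simp [h] at hz
    rw [iterKernel_shifted_apply, iterKernel_shifted_apply, if_neg hne]
    exact ENNReal.ofReal_le_ofReal (hz.2.trans hδη)
  lift mergingTime (shifted K g) η to ℕ using (ne_top_of_le_ne_top (ENat.natCast_ne_top n) hle)
    with T
  exact ⟨T, rfl, by exact_mod_cast hle⟩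

section Circle

variable {N : ℕ} {ε : ℝ}

theorem IsInvariantProb.isMarkovWith (hN : 2 ≤ N) (hε : 0 < ε)
    {g : Equiv.Perm (ZMod (N + 1))} {π : ZMod (N + 1) → ℝ}
    (hπ : IsInvariantProb (tilde (lazyCircle N ε) g) π) :
    IsMarkovWith (tilde (lazyCircle N ε) g) π where
  nonneg := tilde_nonneg hN hε g
  row_sum := tilde_row_sum hN hε g
  weight_nonneg := hπ.1
  invariant y := congrFun hπ.2.2 y

theorem IsInvariantProb.inv_div_card_le (hN : 2 ≤ N) (hε : 0 < ε)
    {g : Equiv.Perm (ZMod (N + 1))} {π : ZMod (N + 1) → ℝ}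
    (hπ : IsInvariantProb (tilde (lazyCircle N ε) g) π) (x : ZMod (N + 1)) :
    (1 + ε)⁻¹ / (N + 1) ≤ π x := by
  have h : (1 : ℝ) ≤ (N + 1) * ((1 + ε) * π x) := by
    refine hπ.2.1.ge.trans ?_
    refine (Finset.sum_le_sum fun y _ => hπ.le_one_add_mul hN hε y x).trans_eq ?_
    simp
  rw [div_le_iff₀ (by positivity), inv_le_iff_one_le_mul₀ (by positivity)]
  linarith

/-- The relative error of the rearranged kernel decays in time of order `(N + 1)²`: both the
kernel and its time reversal satisfy the hypotheses of the `L²` convergence bound, along the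
cyclic order permuted by `g` and along the standard one, respectively. -/
theorem IsInvariantProb.abs_relative_error_le (hN : 2 ≤ N) (hε : 0 < ε)
    {g : Equiv.Perm (ZMod (N + 1))} {π : ZMod (N + 1) → ℝ}
    (hπ : IsInvariantProb (tilde (lazyCircle N ε) g) π) {a β t : ℝ} (ha : a = (1 + ε)⁻¹)
    (hβ : β = a * (1 / (2 * (2 + ε)))) (ht : t = a ^ 2 * β ^ 2 / 64 / (N + 1) ^ 2)
    {k : ℕ} (hk : 1 / (2 * t) ≤ k) (j : ℕ) (x z : ZMod (N + 1)) :
    |(tilde (lazyCircle N ε) g ^ ((k + j) + (k + j))) x z / π z - 1| ≤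
      Real.exp (-(t * j)) := by
  have hμ := hπ.pos hN hε
  have hK := hπ.isMarkovWith hN hε
  have ha0 : 0 < a := by rw [ha]; positivity
  have ha1 : a ≤ 1 := by rw [ha]; exact inv_le_one_of_one_le₀ (by linarith)
  have hb0 : 0 < 1 / (2 * (2 + ε)) := by positivity
  have hβ0 : 0 < β := by rw [hβ]; positivity
  have hβb : β ≤ 1 / (2 * (2 + ε)) := by
    rw [hβ]; exact mul_le_of_le_one_left hb0.le ha1
  have hlow : ∀ x, a / (N + 1) ≤ π x := fun x => ha ▸ hπ.inv_div_card_le hN hε x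
  have hb2 : 1 / (2 * (2 + ε)) ≤ 1 / 2 := by linarith [lightStep_le_quarter hε]
  have hrev : ∀ x z, 1 / (2 * (2 + ε)) ≤ tilde (lazyCircle N ε) g x z →
      β ≤ timeReversal (tilde (lazyCircle N ε) g) π z x := by
    intro x z h
    rw [timeReversal, le_div_iff₀ (hμ z), hβ]
    have h1 : a * π z ≤ π x := by
      rw [ha, inv_mul_le_iff₀ (by linarith)]; exact hπ.le_one_add_mul hN hε z x
    calc a * (1 / (2 * (2 + ε))) * π z = a * π z * (1 / (2 * (2 + ε))) := by ring
      _ ≤ _ := mul_le_mul h1 h hb0.le (hμ x).le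
  have hstay : ∀ x, 1 / (2 * (2 + ε)) ≤ tilde (lazyCircle N ε) g x (g x) := fun x => by
    simpa [tilde, lazyCircle_self] using hb2
  have hup : ∀ x, 1 / (2 * (2 + ε)) ≤ tilde (lazyCircle N ε) g x (g (x + 1)) := fun x => by
    simpa [tilde] using lightStep_le_lazyCircle_up hN hε x
  have hdown : ∀ x, 1 / (2 * (2 + ε)) ≤ tilde (lazyCircle N ε) g (x + 1) (g x) := fun x => by
    simpa [tilde] using lightStep_le_lazyCircle_down hN hε x
  have h1 := hK.sum_mul_pow_mulVec_sq_le (e := g) (e' := 1) ha0 ha1 hβ0 hlow hπ.2.1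
    (fun x => hβb.trans (hstay x)) (fun x => hβb.trans (hup x))
    (sum_mul_centeredDelta hμ hπ.2.1 z) (sum_mul_abs_centeredDelta_le hμ hπ.2.1 z) ht hk j
  have h2 := (hK.reversed hμ).sum_mul_pow_mulVec_sq_le (e := 1) (e' := g) ha0 ha1 hβ0
    hlow hπ.2.1 (fun x => hrev _ _ (hstay x)) (fun x => hrev _ _ (hdown x))
    (sum_mul_centeredDelta hμ hπ.2.1 x) (sum_mul_abs_centeredDelta_le hμ hπ.2.1 x) ht hk j
  refine abs_le_of_sq_le_sq ((hK.sq_relative_error_le hμ hπ.2.1 _ x z).trans ?_)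
    (Real.exp_pos _).le
  rw [sq]
  exact mul_le_mul h2 h1 (Finset.sum_nonneg fun w _ => mul_nonneg (hμ w).le (sq_nonneg _))
    (Real.exp_pos _).le

/-- There is an integer time of order `t⁻¹ * (1 + log₊ (1 / η))` at which the exponential bound
falls below `min 1 η / 8`. -/
theorem exists_times {t η : ℝ} (ht : 0 < t) (ht1 : t ≤ 1) (hη : 0 < η) :
    ∃ k j : ℕ, 1 / (2 * t) ≤ k ∧ Real.exp (-(t * j)) ≤ min 1 η / 8 ∧
      (((k + j) + (k + j) : ℕ) : ℝ) ≤ 11 / t * (1 + Real.posLog (1 / η)) := by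
  set L := Real.posLog (1 / η) with hL
  have hL0 : 0 ≤ L := Real.posLog_nonneg
  refine ⟨⌈1 / (2 * t)⌉₊, ⌈3 * (1 + L) / t⌉₊, Nat.le_ceil _, ?_, ?_⟩
  · have h1 : 3 * (1 + L) ≤ t * ⌈3 * (1 + L) / t⌉₊ := by
      rw [mul_comm t, ← div_le_iff₀ ht]; exact Nat.le_ceil _
    have h8 : Real.log 8 ≤ 3 := by
      have : Real.log 8 = 3 * Real.log 2 := by
        rw [show (8 : ℝ) = 2 ^ 3 by norm_num, Real.log_pow]; norm_num
      linarith [Real.log_two_lt_d9]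
    have hmin : 0 < min 1 η := lt_min one_pos hη
    have hlog : -Real.log (min 1 η) ≤ L := by
      rcases min_choice 1 η with h | h <;> rw [h]
      · simpa using hL0
      · rw [← Real.log_inv, ← one_div]; exact le_max_right _ _
    rw [← Real.le_log_iff_exp_le (by positivity), Real.log_div hmin.ne' (by norm_num)]
    linarith
  · have c1 : (⌈1 / (2 * t)⌉₊ : ℝ) ≤ 1 / (2 * t) + 1 := (Nat.ceil_lt_add_one (by positivity)).le
    have c2 : (⌈3 * (1 + L) / t⌉₊ : ℝ) ≤ 3 * (1 + L) / t + 1 :=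
      (Nat.ceil_lt_add_one (by positivity)).le
    push_cast
    calc _ ≤ 2 * (1 / (2 * t) + 1) + 2 * (3 * (1 + L) / t + 1) := by linarith
      _ = (1 + 4 * t + 6 * (1 + L)) / t := by field_simp; ring
      _ ≤ 11 * (1 + L) / t := by gcongr; linarith
      _ = _ := by ring

end Circle

end WaveChain

theorem mainTheorem3 (ε : ℝ) (hε : 0 < ε) :
    (∀ (N : ℕ), 2 ≤ N → ∀ g : Equiv.Perm (ZMod (N + 1)),
      ∃ π : ZMod (N + 1) → ℝ,
        WaveChain.IsInvariantProb (WaveChain.tilde (WaveChain.lazyCircle N ε) g) π ∧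
        (∀ π' : ZMod (N + 1) → ℝ,
          WaveChain.IsInvariantProb (WaveChain.tilde (WaveChain.lazyCircle N ε) g) π' →
            π' = π) ∧
        Finset.univ.sup' Finset.univ_nonempty π
          ≤ (1 + ε) * Finset.univ.inf' Finset.univ_nonempty π) ∧
    (∃ C : ℝ, 0 < C ∧
      ∀ (N : ℕ), 2 ≤ N → ∀ (g : Equiv.Perm (ZMod (N + 1))) (η : ℝ), 0 < η →
        ∃ T : ℕ,
          WaveChain.mergingTime (WaveChain.shifted (WaveChain.lazyCircle N ε) g) η = (T : ℕ∞) ∧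
          (T : ℝ) ≤ C * (N : ℝ) ^ 2 * (1 + Real.posLog (1 / η))) := by
  constructor
  · intro N hN g
    obtain ⟨π, hπ⟩ := WaveChain.exists_isInvariantProb (WaveChain.tilde_nonneg hN hε g)
      (WaveChain.tilde_row_sum hN hε g)
    refine ⟨π, hπ, fun π' hπ' => hπ.unique hN hε hπ', ?_⟩
    obtain ⟨y, -, hy⟩ := Finset.exists_mem_eq_inf' Finset.univ_nonempty π
    rw [hy]
    exact Finset.sup'_le _ _ fun x _ => hπ.le_one_add_mul hN hε x y
  · obtain ⟨a, ha⟩ : ∃ a : ℝ, a = (1 + ε)⁻¹ := ⟨_, rfl⟩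
    obtain ⟨β, hβ⟩ : ∃ β : ℝ, β = a * (1 / (2 * (2 + ε))) := ⟨_, rfl⟩
    have ha0 : 0 < a := by rw [ha]; positivity
    have ha1 : a ≤ 1 := by rw [ha]; exact inv_le_one_of_one_le₀ (by linarith)
    have hβ0 : 0 < β := by rw [hβ]; positivity
    have hβ1 : β ≤ 1 := by
      rw [hβ]
      exact mul_le_one₀ ha1 (by positivity)
        (by linarith [WaveChain.lightStep_le_quarter hε])
    set κ := a ^ 2 * β ^ 2 / 64 with hκ
    have hκ0 : 0 < κ := by positivity
    have hκ1 : κ ≤ 1 := by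
      have : a ^ 2 * β ^ 2 ≤ 1 :=
        mul_le_one₀ (pow_le_one₀ ha0.le ha1) (by positivity) (pow_le_one₀ hβ0.le hβ1)
      rw [hκ]; linarith
    -- `11 / t = 11 * (N + 1) ^ 2 / κ`, and `N + 1 ≤ 2 * N`.
    refine ⟨44 / κ, by positivity, fun N hN g η hη => ?_⟩
    have hN1 : (1 : ℝ) ≤ N := by exact_mod_cast (by omega : 1 ≤ N)
    set t := κ / (N + 1) ^ 2 with ht
    have ht0 : 0 < t := by positivity
    have ht1 : t ≤ 1 := by
      rw [ht, div_le_one (by positivity)]; nlinarith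
    obtain ⟨π, hπ⟩ := WaveChain.exists_isInvariantProb (WaveChain.tilde_nonneg hN hε g)
      (WaveChain.tilde_row_sum hN hε g)
    obtain ⟨k, j, hk, hj, hkj⟩ := WaveChain.exists_times ht0 ht1 hη
    obtain ⟨T, hT, hTn⟩ := WaveChain.exists_mergingTime_eq_of_relative_error
      (n := (k + j) + (k + j)) hη
      (by linarith [min_le_left 1 η]) (by linarith [min_le_right 1 η])
      fun x z => (hπ.abs_relative_error_le hN hε ha hβ ht hk j x z).trans hj
    refine ⟨T, hT, (Nat.cast_le.2 hTn).trans (hkj.trans ?_)⟩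
    have hL0 : 0 ≤ Real.posLog (1 / η) := Real.posLog_nonneg
    refine mul_le_mul_of_nonneg_right ?_ (by linarith)
    rw [ht, div_div_eq_mul_div, div_mul_eq_mul_div]
    exact div_le_div_of_nonneg_right (by nlinarith) hκ0.le
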